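/- Let $c_1,c_2\in\mathbb{R}$ be not both zero, and let $M^2(c)$ denote the two-dimensional space form of constant curvature $c$: the sphere of radius $1/\sqrt{c}$ in $\mathbb{E}^3$ if $c>0$, the Euclidean plane if $c=0$, and the upper sheet of the hyperboloid $\langle x,x\rangle_1=1/c$ in Minkowski space $\mathbb{R}^3_1$ if $c<0$. Let $F(X_1+X_2)=X_1-X_2$ be the product structure of the Riemannian product $M^2(c_1)\times M^2(c_2)$, where $X_1,X_2$ are the components of a tangent vector tangent to the first and second factor. For a smooth surface $M^2$ immersed in $M^2(c_1)\times M^2(c_2)$, with the induced metric, let $f$ be the symmetric $(1,1)$-tensor on $M^2$ such that $fX$ is the tangential part of $FX$, for every tangent vector $X$ of $M^2$. Let $\lambda_1\le\lambda_2$ be the eigenvalues of $f$, counted with multiplicity; they lie in $[-1,1]$, and the angle functions $\theta_1,\theta_2$ with values in $[0,\frac{\pi}{2}]$ are defined by $\lambda_i=\cos(2\theta_i)$. The surface is called a constant angle surface if $\theta_1$ and $\theta_2$ are constant, and totally geodesic if its second fundamental form vanishes. **Proposition.** Every connected totally geodesic surface $M^2$ of $M^2(c_1)\times M^2(c_2)$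 is a constant angle surface. Moreover, with $a=\frac{c_1+c_2}{4}$ and $b=\frac{c_1-c_2}{4}$, the constant eigenvalues $\lambda_1\le\lambda_2$ of $f$ satisfy $$(a\lambda_1+b)(1-\lambda_2^2)=0=(a\lambda_2+b)(1-\lambda_1^2),$$ and, after possibly interchanging $\lambda_1$ and $\lambda_2$, they are of one of the following types: 1. $\lambda_1=\lambda_2=-\frac{b}{a}=\frac{c_2-c_1}{c_1+c_2}$, and $c_1c_2>0$; 2. $\lambda_1=\pm1$ and $\lambda_2=\pm1$ (with independent signs); 3. $\lambda_1=\pm1$ and $\lambda_2=-\frac{b}{a}$, and $c_1c_2>0$; 4. $\lambda_1=1$, $\lambda_2\in[-1,1]$ and $c_1=0$; or $\lambda_1=-1$, $\lambda_2\in[-1,1]$ and $c_2=0$. -/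

import Mathlib

open scoped Manifold ContDiff

noncomputable section

namespace ProductSurface

/-- Three-dimensional real coordinate space, in which the space forms `M²(c)` are realised.
The metric on it is given by `ambientForm c`; its norm is only used for the topology. -/
abbrev E3 : Type := EuclideanSpace ℝ (Fin 3)

/-- The vector space `ℝ³ × ℝ³` containing `M²(c₁) × M²(c₂)`. -/
abbrev W : Type := E3 × E3

/-- The plane on which surfaces are modelled. -/
abbrev E2 : Type := EuclideanSpace ℝ (Fin 2)

/-- The sign of the first coordinate in the scalar product: `-1` if `c < 0`, else `1`. -/
def formSign (c : ℝ) : ℝ := if c < 0 then -1 else 1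

/-- The Euclidean scalar product of `ℝ³` if `0 ≤ c`, and the Lorentzian scalar product
`-x₀y₀ + x₁y₁ + x₂y₂` if `c < 0`. -/
def ambientForm (c : ℝ) : LinearMap.BilinForm ℝ E3 :=
  LinearMap.mk₂ ℝ
    (fun x y => formSign c * (x 0 * y 0) + x 1 * y 1 + x 2 * y 2)
    (fun x x' y => by simp; ring) (fun a x y => by simp; ring)
    (fun x y y' => by simp; ring) (fun a x y => by simp; ring)

lemma ambientForm_apply (c : ℝ) (x y : E3) :
    ambientForm c x y =
      formSign c * (x 0 * y 0) + x 1 * y 1 + x 2 * y 2 := rfl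

/-- The model `M²(c)` of the complete simply connected surface of constant curvature `c`:
the sphere of radius `1/√c` in Euclidean space if `c > 0`, the upper sheet of the hyperboloid
`⟨x, x⟩₁ = 1/c` in Minkowski space if `c < 0`, and the Euclidean plane `x₀ = 0` if `c = 0`. -/
def spaceForm (c : ℝ) : Set E3 :=
  {x | (c = 0 → x 0 = 0) ∧ (c ≠ 0 → ambientForm c x x = 1 / c) ∧ (c < 0 → 0 < x 0)}

/-- The tangent plane of `M²(c)` at `x`. -/
def tangentPlane (c : ℝ) (x : E3) : Set E3 :=
  {v | (c = 0 → v 0 = 0) ∧ (c ≠ 0 → ambientForm c x v = 0)}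

/-- The orthogonal projection, with respect to `ambientForm c`, of `ℝ³` onto the tangent plane
of `M²(c)` at a point `x` of `M²(c)`. -/
def tangentProj (c : ℝ) (x v : E3) : E3 :=
  if c = 0 then v - v 0 • EuclideanSpace.single 0 1 else v - (c * ambientForm c x v) • x

/-- The product `M²(c₁) × M²(c₂)`. -/
def productSpace (c₁ c₂ : ℝ) : Set W := spaceForm c₁ ×ˢ spaceForm c₂

/-- The product scalar product on `ℝ³ × ℝ³`; on the tangent spaces of `M²(c₁) × M²(c₂)` it is
the product Riemannian metric. -/
def productForm (c₁ c₂ : ℝ) : LinearMap.BilinForm ℝ W :=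
  (ambientForm c₁).compl₁₂ (LinearMap.fst ℝ E3 E3) (LinearMap.fst ℝ E3 E3) +
    (ambientForm c₂).compl₁₂ (LinearMap.snd ℝ E3 E3) (LinearMap.snd ℝ E3 E3)

lemma productForm_apply (c₁ c₂ : ℝ) (x y : W) :
    productForm c₁ c₂ x y = ambientForm c₁ x.1 y.1 + ambientForm c₂ x.2 y.2 := rfl

/-- The orthogonal projection of `ℝ³ × ℝ³` onto the tangent space of `M²(c₁) × M²(c₂)` at `x`. -/
def productTangentProj (c₁ c₂ : ℝ) (x v : W) : W :=
  (tangentProj c₁ x.1 v.1, tangentProj c₂ x.2 v.2)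

/-- The product structure `F (X₁ + X₂) = X₁ - X₂`. -/
def productStructure : W →ₗ[ℝ] W :=
  LinearMap.prodMap LinearMap.id (-LinearMap.id)

lemma ambientForm_pos {c : ℝ} {x v : E3} (hx : x ∈ spaceForm c) (hv : v ∈ tangentPlane c x)
    (hv0 : v ≠ 0) : 0 < ambientForm c v v := by
  have hne : v 0 ≠ 0 ∨ v 1 ≠ 0 ∨ v 2 ≠ 0 := by
    by_contra! h
    apply hv0
    ext i
    fin_cases i
    · exact h.1
    · exact h.2.1
    · exact h.2.2
  rw [ambientForm_apply]
  by_cases hc : c < 0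
  · have h1 := hx.2.1 hc.ne
    have h2 := hv.2 hc.ne
    have h3 := hx.2.2 hc
    rw [ambientForm_apply, formSign, if_pos hc] at h1 h2
    rw [formSign, if_pos hc]
    have hc' : 1 / c < 0 := by simpa using hc
    have h12 : 0 < v 1 ^ 2 + v 2 ^ 2 := by
      by_contra! h
      have e1 : v 1 = 0 := by nlinarith [sq_nonneg (v 1), sq_nonneg (v 2)]
      have e2 : v 2 = 0 := by nlinarith [sq_nonneg (v 1), sq_nonneg (v 2)]
      rw [e1, e2] at h2
      have e0 : x 0 * v 0 = 0 := by linarith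
      have e0' : v 0 = 0 := (mul_eq_zero.mp e0).resolve_left h3.ne'
      simp [e0', e1, e2] at hne
    have key : (x 0) ^ 2 * (v 0) ^ 2 ≤ (x 1 ^ 2 + x 2 ^ 2) * (v 1 ^ 2 + v 2 ^ 2) := by
      have e : x 0 * v 0 = x 1 * v 1 + x 2 * v 2 := by linarith
      have : (x 0) ^ 2 * (v 0) ^ 2 = (x 1 * v 1 + x 2 * v 2) ^ 2 := by rw [← e]; ring
      nlinarith [sq_nonneg (x 1 * v 2 - x 2 * v 1)]
    have h4 : 0 < (x 0) ^ 2 * (-1 * (v 0 * v 0) + v 1 * v 1 + v 2 * v 2) := by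
      have e : (x 0) ^ 2 = x 1 ^ 2 + x 2 ^ 2 - 1 / c := by nlinarith
      have : 0 < -(1 / c) * (v 1 ^ 2 + v 2 ^ 2) := mul_pos (by linarith) h12
      nlinarith
    exact pos_of_mul_pos_right h4 (sq_nonneg _)
  · rw [formSign, if_neg hc]
    rcases hne with h | h | h
    · nlinarith [mul_self_pos.2 h, mul_self_nonneg (v 1), mul_self_nonneg (v 2)]
    · nlinarith [mul_self_pos.2 h, mul_self_nonneg (v 0), mul_self_nonneg (v 2)]
    · nlinarith [mul_self_pos.2 h, mul_self_nonneg (v 1), mul_self_nonneg (v 0)]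

lemma ambientForm_comm (c : ℝ) (x y : E3) : ambientForm c x y = ambientForm c y x := by
  simp only [ambientForm_apply]; ring

lemma ambientForm_self_nonneg {c : ℝ} {x v : E3} (hx : x ∈ spaceForm c)
    (hv : v ∈ tangentPlane c x) : 0 ≤ ambientForm c v v := by
  by_cases h : v = 0
  · simp [h]
  · exact (ambientForm_pos hx hv h).le

/-- A smooth surface immersed in `M²(c₁) × M²(c₂)`: a smooth map from a two-dimensional
manifold `M` with values in `M²(c₁) × M²(c₂)` and with injective differential. The surface `M`
carries the induced metric. -/
structure ImmersedSurface (c₁ c₂ : ℝ) (M : Type*) [TopologicalSpace M] [ChartedSpace E2 M]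
    [IsManifold (𝓡 2) ∞ M] where
  toFun : M → W
  contMDiff : ContMDiff (𝓡 2) 𝓘(ℝ, W) ∞ toFun
  mem_productSpace : ∀ p, toFun p ∈ productSpace c₁ c₂
  injective_mfderiv : ∀ p, Function.Injective (mfderiv (𝓡 2) 𝓘(ℝ, W) toFun p)

namespace ImmersedSurface

variable {c₁ c₂ : ℝ} {M : Type*} [TopologicalSpace M] [ChartedSpace E2 M]
  [IsManifold (𝓡 2) ∞ M]

/-- The differential of the immersion at `p`. -/
def diff (ψ : ImmersedSurface c₁ c₂ M) (p : M) : TangentSpace (𝓡 2) p →ₗ[ℝ] W :=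
  (mfderiv (𝓡 2) 𝓘(ℝ, W) ψ.toFun p).toLinearMap

lemma const_comp_diff (ψ : ImmersedSurface c₁ c₂ M) (p : M) (u : TangentSpace (𝓡 2) p)
    {q : W → ℝ} {q' : W →L[ℝ] ℝ} (hq : HasFDerivAt q q' (ψ.toFun p)) {a : ℝ}
    (ha : ∀ m, q (ψ.toFun m) = a) : q' (ψ.diff p u) = 0 := by
  have h1 : HasMFDerivAt (𝓡 2) 𝓘(ℝ, W) ψ.toFun p (mfderiv (𝓡 2) 𝓘(ℝ, W) ψ.toFun p) :=
    ((ψ.contMDiff p).mdifferentiableAt (by simp)).hasMFDerivAt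
  have h2 := hq.hasMFDerivAt.comp p h1
  have h3 : (q ∘ ψ.toFun) = fun _ => a := funext ha
  rw [h3] at h2
  have h4 := hasMFDerivAt_unique h2 (hasMFDerivAt_const a p)
  exact DFunLike.congr_fun h4 u

lemma diff_fst_mem (ψ : ImmersedSurface c₁ c₂ M) (p : M) (u : TangentSpace (𝓡 2) p) :
    (ψ.diff p u).1 ∈ tangentPlane c₁ (ψ.toFun p).1 := by
  have hpr : ∀ i : Fin 3, HasFDerivAt (fun x : W => x.1 i)
      ((EuclideanSpace.proj i : E3 →L[ℝ] ℝ).comp (ContinuousLinearMap.fst ℝ E3 E3))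
      (ψ.toFun p) := fun i =>
    ((EuclideanSpace.proj i : E3 →L[ℝ] ℝ).comp (ContinuousLinearMap.fst ℝ E3 E3)).hasFDerivAt
  refine ⟨fun hc => ?_, fun hc => ?_⟩
  · simpa using ψ.const_comp_diff p u (hpr 0) (fun m => (ψ.mem_productSpace m).1.1 hc)
  · have := ψ.const_comp_diff p u
      (((((hpr 0).mul (hpr 0)).const_mul (formSign c₁)).add
        ((hpr 1).mul (hpr 1))).add ((hpr 2).mul (hpr 2)))
      (fun m => (ψ.mem_productSpace m).1.2.1 hc)
    simp at this
    rw [ambientForm_apply]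
    linarith

lemma diff_snd_mem (ψ : ImmersedSurface c₁ c₂ M) (p : M) (u : TangentSpace (𝓡 2) p) :
    (ψ.diff p u).2 ∈ tangentPlane c₂ (ψ.toFun p).2 := by
  have hpr : ∀ i : Fin 3, HasFDerivAt (fun x : W => x.2 i)
      ((EuclideanSpace.proj i : E3 →L[ℝ] ℝ).comp (ContinuousLinearMap.snd ℝ E3 E3))
      (ψ.toFun p) := fun i =>
    ((EuclideanSpace.proj i : E3 →L[ℝ] ℝ).comp (ContinuousLinearMap.snd ℝ E3 E3)).hasFDerivAt
  refine ⟨fun hc => ?_, fun hc => ?_⟩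
  · simpa using ψ.const_comp_diff p u (hpr 0) (fun m => (ψ.mem_productSpace m).2.1 hc)
  · have := ψ.const_comp_diff p u
      (((((hpr 0).mul (hpr 0)).const_mul (formSign c₂)).add
        ((hpr 1).mul (hpr 1))).add ((hpr 2).mul (hpr 2)))
      (fun m => (ψ.mem_productSpace m).2.2.1 hc)
    simp at this
    rw [ambientForm_apply]
    linarith

/-- The induced Riemannian metric on `M` at `p`. -/
def metric (ψ : ImmersedSurface c₁ c₂ M) (p : M) :
    LinearMap.BilinForm ℝ (TangentSpace (𝓡 2) p) :=
  (productForm c₁ c₂).compl₁₂ (ψ.diff p) (ψ.diff p)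

lemma metric_pos (ψ : ImmersedSurface c₁ c₂ M) (p : M) {u : TangentSpace (𝓡 2) p}
    (hu : u ≠ 0) : 0 < ψ.metric p u u := by
  have h : ψ.diff p u ≠ 0 := fun h =>
    hu (ψ.injective_mfderiv p (h.trans (map_zero (ψ.diff p)).symm))
  change 0 < ambientForm c₁ (ψ.diff p u).1 (ψ.diff p u).1 +
    ambientForm c₂ (ψ.diff p u).2 (ψ.diff p u).2
  have m := ψ.mem_productSpace p
  have n1 := ambientForm_self_nonneg m.1 (ψ.diff_fst_mem p u)
  have n2 := ambientForm_self_nonneg m.2 (ψ.diff_snd_mem p u)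
  by_cases h1 : (ψ.diff p u).1 = 0
  · have h2 : (ψ.diff p u).2 ≠ 0 := fun h2 => h (Prod.ext h1 h2)
    have := ambientForm_pos m.2 (ψ.diff_snd_mem p u) h2
    linarith
  · have := ambientForm_pos m.1 (ψ.diff_fst_mem p u) h1
    linarith

lemma metric_nondegenerate (ψ : ImmersedSurface c₁ c₂ M) (p : M) :
    (ψ.metric p).Nondegenerate := by
  constructor
  · intro u hu
    by_contra h
    exact (ψ.metric_pos p h).ne' (hu u)
  · intro u hu
    by_contra h
    exact (ψ.metric_pos p h).ne' (hu u)

instance finiteDimensional_tangentSpace (p : M) :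
    FiniteDimensional ℝ (TangentSpace (𝓡 2) p) :=
  inferInstanceAs (FiniteDimensional ℝ E2)

/-- The tangential part of a vector `x` at `ψ p`, as a tangent vector of `M` at `p`: the unique
`u` with `⟨dψ u, dψ v⟩ = ⟨x, dψ v⟩` for all `v`. -/
def tangentPart (ψ : ImmersedSurface c₁ c₂ M) (p : M) : W →ₗ[ℝ] TangentSpace (𝓡 2) p :=
  (LinearMap.BilinForm.toDual (ψ.metric p) (ψ.metric_nondegenerate p)).symm.toLinearMap ∘ₗ
    (productForm c₁ c₂).compl₁₂ LinearMap.id (ψ.diff p)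

/-- `x - dψ (tangentPart x)` is orthogonal to the surface. -/
lemma productForm_sub_tangentPart (ψ : ImmersedSurface c₁ c₂ M) (p : M) (x : W)
    (v : TangentSpace (𝓡 2) p) :
    productForm c₁ c₂ (x - ψ.diff p (ψ.tangentPart p x)) (ψ.diff p v) = 0 := by
  have h : ψ.metric p (ψ.tangentPart p x) v = productForm c₁ c₂ x (ψ.diff p v) :=
    LinearMap.BilinForm.apply_toDual_symm_apply (hB := ψ.metric_nondegenerate p) _ v
  rw [map_sub, LinearMap.sub_apply, ← h]
  exact sub_self _

/-- The `(1,1)`-tensor `f` at `p`: `f X` is the tangential part of `F X`. -/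
def f (ψ : ImmersedSurface c₁ c₂ M) (p : M) :
    TangentSpace (𝓡 2) p →ₗ[ℝ] TangentSpace (𝓡 2) p :=
  ψ.tangentPart p ∘ₗ productStructure ∘ₗ ψ.diff p

/-- The covariant derivative at `p`, for the Levi-Civita connection of `M²(c₁) × M²(c₂)`, in
direction `u` of the field `dψ V`, where `V` is the vector field with constant coordinates `v`
in the preferred chart at `p` (this chart identifies the tangent space at `p` with `ℝ²`): the
flat derivative of `dψ V` in direction `u`, projected onto the tangent space of
`M²(c₁) × M²(c₂)`. -/
def covDeriv (ψ : ImmersedSurface c₁ c₂ M) (p : M) (u v : TangentSpace (𝓡 2) p) : W :=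
  productTangentProj c₁ c₂ (ψ.toFun p)
    (fderiv ℝ (fun y => fderiv ℝ (ψ.toFun ∘ (extChartAt (𝓡 2) p).symm) y (v : E2))
      (extChartAt (𝓡 2) p p) (u : E2))

/-- The second fundamental form: the part of the covariant derivative normal to the surface. -/
def secondFundamentalForm (ψ : ImmersedSurface c₁ c₂ M) (p : M)
    (u v : TangentSpace (𝓡 2) p) : W :=
  ψ.covDeriv p u v - ψ.diff p (ψ.tangentPart p (ψ.covDeriv p u v))

/-- The surface is totally geodesic: its second fundamental form vanishes. -/
def IsTotallyGeodesic (ψ : ImmersedSurface c₁ c₂ M) : Prop :=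
  ∀ (p : M) (u v : TangentSpace (𝓡 2) p), ψ.secondFundamentalForm p u v = 0

/-- `l₁ ≤ l₂` are the eigenvalues of `f` at `p`, counted with multiplicity. -/
def HasEigenvaluesAt (ψ : ImmersedSurface c₁ c₂ M) (p : M) (l₁ l₂ : ℝ) : Prop :=
  l₁ ≤ l₂ ∧ (ψ.f p).charpoly =
    (Polynomial.X - Polynomial.C l₁) * (Polynomial.X - Polynomial.C l₂)

/-- `θ₁`, `θ₂` are the angle functions: they take values in `[0, π/2]` and
`cos (2 θ₁) ≤ cos (2 θ₂)` are the eigenvalues of `f`. -/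
def IsAngleFunctions (ψ : ImmersedSurface c₁ c₂ M) (θ₁ θ₂ : M → ℝ) : Prop :=
  ∀ p, θ₁ p ∈ Set.Icc 0 (Real.pi / 2) ∧ θ₂ p ∈ Set.Icc 0 (Real.pi / 2) ∧
    ψ.HasEigenvaluesAt p (Real.cos (2 * θ₁ p)) (Real.cos (2 * θ₂ p))

/-- The surface is a constant angle surface: its angle functions are constant. -/
def IsConstantAngle (ψ : ImmersedSurface c₁ c₂ M) : Prop :=
  ∃ t₁ t₂ : ℝ, ψ.IsAngleFunctions (fun _ => t₁) (fun _ => t₂)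

end ImmersedSurface

/-- The four types of pairs of eigenvalues (the fourth one has a case `c₁ = 0` and a case
`c₂ = 0`). -/
def EigenvalueTypes (c₁ c₂ l₁ l₂ : ℝ) : Prop :=
  (0 < c₁ * c₂ ∧ l₁ = (c₂ - c₁) / (c₁ + c₂) ∧ l₂ = (c₂ - c₁) / (c₁ + c₂)) ∨
  ((l₁ = 1 ∨ l₁ = -1) ∧ (l₂ = 1 ∨ l₂ = -1)) ∨
  (0 < c₁ * c₂ ∧ (l₁ = 1 ∨ l₁ = -1) ∧ l₂ = (c₂ - c₁) / (c₁ + c₂)) ∨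
  ((c₁ = 0 ∧ l₁ = 1 ∧ l₂ ∈ Set.Icc (-1 : ℝ) 1) ∨
    (c₂ = 0 ∧ l₁ = -1 ∧ l₂ ∈ Set.Icc (-1 : ℝ) 1))

end ProductSurface

end

noncomputable section

namespace ProductSurface

/-! ### Linear algebra of the pencil spanned by the two partial metrics -/

/-- The standard basis of the model plane. -/
def planeBasis : Module.Basis (Fin 2) ℝ E2 := (EuclideanSpace.basisFun (Fin 2) ℝ).toBasis

/-- The form `s ⟨(L u)₁, (L v)₁⟩ + t ⟨(L u)₂, (L v)₂⟩` on the model plane. -/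
def pencil (c₁ c₂ s t : ℝ) (L : E2 →ₗ[ℝ] W) : LinearMap.BilinForm ℝ E2 :=
  s • (ambientForm c₁).compl₁₂ (LinearMap.fst ℝ E3 E3 ∘ₗ L) (LinearMap.fst ℝ E3 E3 ∘ₗ L) +
    t • (ambientForm c₂).compl₁₂ (LinearMap.snd ℝ E3 E3 ∘ₗ L) (LinearMap.snd ℝ E3 E3 ∘ₗ L)

lemma pencil_apply (c₁ c₂ s t : ℝ) (L : E2 →ₗ[ℝ] W) (u v : E2) :
    pencil c₁ c₂ s t L u v =
      s * ambientForm c₁ (L u).1 (L v).1 + t * ambientForm c₂ (L u).2 (L v).2 := rfl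

lemma pencil_comm (c₁ c₂ s t : ℝ) (L : E2 →ₗ[ℝ] W) (u v : E2) :
    pencil c₁ c₂ s t L u v = pencil c₁ c₂ s t L v u := by
  simp only [pencil_apply, ambientForm_comm]

/-- The determinant of the Gram matrix of the pencil form in the standard basis. -/
def pencilDet (c₁ c₂ s t : ℝ) (L : E2 →ₗ[ℝ] W) : ℝ :=
  (LinearMap.BilinForm.toMatrix planeBasis (pencil c₁ c₂ s t L)).det

lemma pencilDet_eq (c₁ c₂ s t : ℝ) (L : E2 →ₗ[ℝ] W) :
    pencilDet c₁ c₂ s t L =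
      pencil c₁ c₂ s t L (planeBasis 0) (planeBasis 0) *
        pencil c₁ c₂ s t L (planeBasis 1) (planeBasis 1) -
      pencil c₁ c₂ s t L (planeBasis 0) (planeBasis 1) ^ 2 := by
  rw [pencilDet, Matrix.det_fin_two]
  simp only [LinearMap.BilinForm.toMatrix_apply]
  rw [pencil_comm _ _ _ _ _ (planeBasis 1) (planeBasis 0), sq]

lemma pencilDet_comp (c₁ c₂ s t : ℝ) (L : E2 →ₗ[ℝ] W) (T : E2 →ₗ[ℝ] E2) :
    pencilDet c₁ c₂ s t (L ∘ₗ T) = LinearMap.det T ^ 2 * pencilDet c₁ c₂ s t L := by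
  have h : pencil c₁ c₂ s t (L ∘ₗ T) = (pencil c₁ c₂ s t L).comp T T := rfl
  rw [pencilDet, h, LinearMap.BilinForm.toMatrix_comp planeBasis planeBasis, Matrix.det_mul,
    Matrix.det_mul, Matrix.det_transpose, LinearMap.det_toMatrix, pencilDet]
  ring

lemma eval_charpoly_mul_pencilDet {c₁ c₂ : ℝ} {L : E2 →ₗ[ℝ] W} {f : E2 →ₗ[ℝ] E2}
    (hf : ∀ u v, pencil c₁ c₂ 1 1 L u (f v) = pencil c₁ c₂ 1 (-1) L u v) (x : ℝ) :
    f.charpoly.eval x * pencilDet c₁ c₂ 1 1 L = pencilDet c₁ c₂ (x - 1) (x + 1) L := by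
  have key : pencil c₁ c₂ (x - 1) (x + 1) L =
      (pencil c₁ c₂ 1 1 L).compRight (x • LinearMap.id - f) := by
    ext u v
    simp only [LinearMap.BilinForm.compRight_apply, LinearMap.sub_apply, map_sub, hf,
      LinearMap.smul_apply, LinearMap.id_apply, map_smul, smul_eq_mul]
    simp only [pencil_apply]
    ring
  rw [pencilDet, pencilDet, key, LinearMap.BilinForm.toMatrix_compRight, Matrix.det_mul,
    LinearMap.det_toMatrix, LinearMap.eval_charpoly, mul_comm]
  rfl

/-- A self-adjoint endomorphism of a Euclidean plane has an orthonormal eigenbasis. -/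
lemma exists_orthonormal_eigenbasis {V : Type*} [AddCommGroup V] [Module ℝ V]
    [FiniteDimensional ℝ V] (hV : Module.finrank ℝ V = 2) (G : LinearMap.BilinForm ℝ V)
    (hG : ∀ u v, G u v = G v u) (hpos : ∀ u, u ≠ 0 → 0 < G u u) (f : V →ₗ[ℝ] V)
    (hf : ∀ u v, G (f u) v = G u (f v)) :
    ∃ (X Y : V) (l₁ l₂ : ℝ), l₁ ≤ l₂ ∧ G X X = 1 ∧ G Y Y = 1 ∧ G X Y = 0 ∧
      f X = l₁ • X ∧ f Y = l₂ • Y ∧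
      f.charpoly = (Polynomial.X - Polynomial.C l₁) * (Polynomial.X - Polynomial.C l₂) := by
  let core : InnerProductSpace.Core ℝ V :=
    { inner := fun u v => G u v
      conj_inner_symm := fun u v => by simpa using hG v u
      re_inner_nonneg := fun u => by
        by_cases h : u = 0
        · simp [h]
        · simpa using (hpos u h).le
      add_left := fun u v w => by simp
      smul_left := fun u v r => by simp
      definite := fun u h => by
        by_contra h0
        exact (hpos u h0).ne' h }
  let : NormedAddCommGroup V := core.toNormedAddCommGroup
  let : InnerProductSpace ℝ V := InnerProductSpace.ofCore core.toCore
  have hsym : f.IsSymmetric := fun u v => hf u v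
  let b := hsym.eigenvectorBasis hV
  let l := hsym.eigenvalues hV
  have hb : ∀ i, f (b i) = l i • b i := fun i => hsym.apply_eigenvectorBasis hV i
  have hin : ∀ i j, G (b i) (b j) = if i = j then 1 else 0 := fun i j =>
    (orthonormal_iff_ite.mp b.orthonormal) i j
  have hchar : f.charpoly =
      (Polynomial.X - Polynomial.C (l 0)) * (Polynomial.X - Polynomial.C (l 1)) := by
    have hm : LinearMap.toMatrix b.toBasis b.toBasis f = Matrix.diagonal l := by
      ext i j
      rw [LinearMap.toMatrix_apply, OrthonormalBasis.coe_toBasis, hb,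
        ← OrthonormalBasis.coe_toBasis, map_smul, Module.Basis.repr_self]
      by_cases h : i = j
      · subst h; simp
      · simp [h]
    rw [← LinearMap.charpoly_toMatrix f b.toBasis, hm, Matrix.charpoly_diagonal, Fin.prod_univ_two]
  rcases le_total (l 0) (l 1) with h | h
  · exact ⟨b 0, b 1, l 0, l 1, h, by simp [hin], by simp [hin], by simp [hin], hb 0, hb 1, hchar⟩
  · exact ⟨b 1, b 0, l 1, l 0, h, by simp [hin], by simp [hin], by simp [hin], hb 1, hb 0,
      hchar.trans (mul_comm _ _)⟩

/-- The tangent plane `range L` is invariant under the curvature tensor of the product. -/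
def CurvatureInvariant (c₁ c₂ : ℝ) (L : E2 →ₗ[ℝ] W) : Prop :=
  ∀ u v w : E2, ∃ r : E2, L r =
    (c₁ • (ambientForm c₁ (L u).1 (L v).1 • (L w).1 - ambientForm c₁ (L u).1 (L w).1 • (L v).1),
      c₂ • (ambientForm c₂ (L u).2 (L v).2 • (L w).2 - ambientForm c₂ (L u).2 (L w).2 • (L v).2))

lemma CurvatureInvariant.eigenvalue_eq {c₁ c₂ : ℝ} {L : E2 →ₗ[ℝ] W}
    (h : CurvatureInvariant c₁ c₂ L) {f : E2 →ₗ[ℝ] E2}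
    (hf : ∀ u v, pencil c₁ c₂ 1 1 L u (f v) = pencil c₁ c₂ 1 (-1) L u v) {X Y : E2} {l m : ℝ}
    (hXX : pencil c₁ c₂ 1 1 L X X = 1) (hYY : pencil c₁ c₂ 1 1 L Y Y = 1)
    (hYX : pencil c₁ c₂ 1 1 L Y X = 0) (hX : f X = l • X) (hY : f Y = m • Y) :
    ((c₁ + c₂) / 4 * m + (c₁ - c₂) / 4) * (1 - l ^ 2) = 0 := by
  obtain ⟨r, hr⟩ := h Y Y X
  have e1 := hf X X
  have e2 := hf Y Y
  have e3 := hf Y X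
  have e4 := hf r X
  rw [hX, map_smul, smul_eq_mul] at e1 e3 e4
  rw [hY, map_smul, smul_eq_mul] at e2
  rw [hXX] at e1
  rw [hYY] at e2
  rw [hYX] at e3
  simp only [pencil_apply, hr, map_smul, map_sub, LinearMap.smul_apply, LinearMap.sub_apply,
    smul_eq_mul] at hXX hYY hYX e1 e2 e3 e4
  have a1 : ambientForm c₁ (L X).1 (L X).1 = (1 + l) / 2 := by linarith
  have b1 : ambientForm c₂ (L X).2 (L X).2 = (1 - l) / 2 := by linarith
  have a2 : ambientForm c₁ (L Y).1 (L Y).1 = (1 + m) / 2 := by linarith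
  have b2 : ambientForm c₂ (L Y).2 (L Y).2 = (1 - m) / 2 := by linarith
  have a3 : ambientForm c₁ (L Y).1 (L X).1 = 0 := by linarith
  have b3 : ambientForm c₂ (L Y).2 (L X).2 = 0 := by linarith
  rw [a1, b1, a2, b2, a3, b3] at e4
  linear_combination -e4

open Filter Topology

/-! ### Differentiation of scalar products and of maps into space forms -/

lemma exists_hasFDerivAt_ambientForm {E : Type*} [NormedAddCommGroup E] [NormedSpace ℝ E]
    (c : ℝ) {a b : E → E3} {a' b' : E →L[ℝ] E3} {y : E}
    (ha : HasFDerivAt a a' y) (hb : HasFDerivAt b b' y) :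
    ∃ D : E →L[ℝ] ℝ, HasFDerivAt (fun z => ambientForm c (a z) (b z)) D y ∧
      ∀ w, D w = ambientForm c (a' w) (b y) + ambientForm c (a y) (b' w) := by
  refine ⟨_, (LinearMap.toContinuousBilinearMap (ambientForm c)).hasFDerivAt_of_bilinear ha hb,
    fun w => ?_⟩
  simp [add_comm]

lemma mul_ambientForm_of_mem {c : ℝ} {x v : E3} (hv : v ∈ tangentPlane c x) :
    c * ambientForm c x v = 0 := by
  by_cases h : c = 0
  · simp [h]
  · simp [hv.2 h]

section SpaceForm

variable {E : Type*} [NormedAddCommGroup E] [NormedSpace ℝ E]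

lemma fderiv_mem_tangentPlane {c : ℝ} {h : E → E3} {h' : E →L[ℝ] E3} {y : E}
    (hh : HasFDerivAt h h' y) (hm : ∀ᶠ z in 𝓝 y, h z ∈ spaceForm c) (v : E) :
    h' v ∈ tangentPlane c (h y) := by
  refine ⟨fun hc => ?_, fun hc => ?_⟩
  · have h1 : HasFDerivAt (fun z => h z 0) ((EuclideanSpace.proj 0 : E3 →L[ℝ] ℝ).comp h') y :=
      (EuclideanSpace.proj 0 : E3 →L[ℝ] ℝ).hasFDerivAt.comp y hh
    have h2 : (fun z => h z 0) =ᶠ[𝓝 y] fun _ => 0 := hm.mono fun z hz => hz.1 hc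
    have h3 := (h1.congr_of_eventuallyEq h2.symm).unique (hasFDerivAt_const 0 y)
    exact DFunLike.congr_fun h3 v
  · obtain ⟨D, hD, hDv⟩ := exists_hasFDerivAt_ambientForm c hh hh
    have h2 : (fun z => ambientForm c (h z) (h z)) =ᶠ[𝓝 y] fun _ => 1 / c :=
      hm.mono fun z hz => hz.2.1 hc
    have h3 := (hD.congr_of_eventuallyEq h2.symm).unique (hasFDerivAt_const _ y)
    have h4 := hDv v
    rw [h3, zero_apply, ambientForm_comm c (h' v)] at h4
    linarith

/-- The Gauss formula of `M²(c)` in `ℝ³`. -/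
lemma tangentProj_second_deriv {c : ℝ} {h : E → E3} {L : E → E →L[ℝ] E3}
    {H : E →L[ℝ] E →L[ℝ] E3} {y : E} (hh : ∀ᶠ z in 𝓝 y, HasFDerivAt h (L z) z)
    (hL : HasFDerivAt L H y) (hm : ∀ᶠ z in 𝓝 y, h z ∈ spaceForm c) (u v : E) :
    tangentProj c (h y) (H u v) =
      H u v + (c * ambientForm c (L y u) (L y v)) • h y := by
  have ht : ∀ᶠ z in 𝓝 y, L z v ∈ tangentPlane c (h z) := by
    filter_upwards [hh, hm.eventually_nhds] with z hz hz'
    exact fderiv_mem_tangentPlane hz hz' v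
  have hLv : HasFDerivAt (fun z => L z v) (H.flip v) y := by
    simpa using hL.clm_apply (hasFDerivAt_const v y)
  unfold tangentProj
  split_ifs with hc
  · have h1 : HasFDerivAt (fun z => L z v 0)
        ((EuclideanSpace.proj 0 : E3 →L[ℝ] ℝ).comp (H.flip v)) y :=
      (EuclideanSpace.proj 0 : E3 →L[ℝ] ℝ).hasFDerivAt.comp y hLv
    have h2 : (fun z => L z v 0) =ᶠ[𝓝 y] fun _ => 0 := ht.mono fun z hz => hz.1 hc
    have h3 := (h1.congr_of_eventuallyEq h2.symm).unique (hasFDerivAt_const 0 y)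
    have h4 : H u v 0 = 0 := DFunLike.congr_fun h3 u
    simp [h4, hc]
  · obtain ⟨D, hD, hDv⟩ := exists_hasFDerivAt_ambientForm c hh.self_of_nhds hLv
    have h2 : (fun z => ambientForm c (h z) (L z v)) =ᶠ[𝓝 y] fun _ => 0 :=
      ht.mono fun z hz => hz.2 hc
    have h3 := (hD.congr_of_eventuallyEq h2.symm).unique (hasFDerivAt_const _ y)
    have h4 := hDv u
    rw [h3, zero_apply, ContinuousLinearMap.flip_apply] at h4
    rw [show c * ambientForm c (h y) (H u v) = -(c * ambientForm c (L y u) (L y v)) by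
      linear_combination -c * h4, neg_smul, sub_neg_eq_add]

end SpaceForm

/-! ### Totally geodesic parametrisations -/

/-- The component of `-D²g (u, v)` normal to the product at `x`, in terms of `a = Dg u`,
`b = Dg v`. -/
def normalCorrection (c₁ c₂ : ℝ) (x a b : W) : W :=
  ((c₁ * ambientForm c₁ a.1 b.1) • x.1, (c₂ * ambientForm c₂ a.2 b.2) • x.2)

/-- `g` is at `y` a smooth immersion into the product with vanishing second fundamental form. -/
structure IsGeodesicAt (c₁ c₂ : ℝ) (g : E2 → W) (y : E2) : Prop where
  contDiffAt : ContDiffAt ℝ ∞ g y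
  mem : g y ∈ productSpace c₁ c₂
  injective : Function.Injective (fderiv ℝ g y)
  range : ∀ u v, ∃ r, fderiv ℝ (fderiv ℝ g) y u v +
    normalCorrection c₁ c₂ (g y) (fderiv ℝ g y u) (fderiv ℝ g y v) = fderiv ℝ g y r

lemma hasFDerivAt_fderiv {g : E2 → W} {y : E2} (hg : ContDiffAt ℝ ∞ g y) :
    HasFDerivAt g (fderiv ℝ g y) y :=
  (hg.differentiableAt (by simp)).hasFDerivAt

lemma contDiffAt_fderiv {F : Type*} [NormedAddCommGroup F] [NormedSpace ℝ F] {g : E2 → F}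
    {y : E2} (hg : ContDiffAt ℝ ∞ g y) : ContDiffAt ℝ ∞ (fderiv ℝ g) y :=
  hg.fderiv_right (by simp)

lemma hasFDerivAt_fderiv' {F : Type*} [NormedAddCommGroup F] [NormedSpace ℝ F] {g : E2 → F}
    {y : E2} (hg : ContDiffAt ℝ ∞ g y) :
    HasFDerivAt (fderiv ℝ g) (fderiv ℝ (fderiv ℝ g) y) y :=
  ((contDiffAt_fderiv hg).differentiableAt (by simp)).hasFDerivAt

lemma hasFDerivAt_fst {E : Type*} [NormedAddCommGroup E] [NormedSpace ℝ E] {g : E → W}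
    {g' : E →L[ℝ] W} {y : E} (hg : HasFDerivAt g g' y) :
    HasFDerivAt (fun z => (g z).1) ((ContinuousLinearMap.fst ℝ E3 E3).comp g') y :=
  (ContinuousLinearMap.fst ℝ E3 E3).hasFDerivAt.comp y hg

lemma hasFDerivAt_snd {E : Type*} [NormedAddCommGroup E] [NormedSpace ℝ E] {g : E → W}
    {g' : E →L[ℝ] W} {y : E} (hg : HasFDerivAt g g' y) :
    HasFDerivAt (fun z => (g z).2) ((ContinuousLinearMap.snd ℝ E3 E3).comp g') y :=
  (ContinuousLinearMap.snd ℝ E3 E3).hasFDerivAt.comp y hg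

/-- The Gauss formula of the product in `ℝ³ × ℝ³`. -/
lemma productTangentProj_second_deriv {c₁ c₂ : ℝ} {g : E2 → W} {y : E2}
    (hg : ContDiffAt ℝ ∞ g y) (hm : ∀ᶠ z in 𝓝 y, g z ∈ productSpace c₁ c₂) (u v : E2) :
    productTangentProj c₁ c₂ (g y) (fderiv ℝ (fderiv ℝ g) y u v) =
      fderiv ℝ (fderiv ℝ g) y u v +
        normalCorrection c₁ c₂ (g y) (fderiv ℝ g y u) (fderiv ℝ g y v) := by
  have h0 : ∀ᶠ z in 𝓝 y, HasFDerivAt g (fderiv ℝ g z) z :=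
    ((hg.of_le (m := 1) (by simp)).eventually (by simp)).mono fun z hz =>
      (hz.differentiableAt (by simp)).hasFDerivAt
  have h1 : HasFDerivAt (fderiv ℝ g) (fderiv ℝ (fderiv ℝ g) y) y :=
    hasFDerivAt_fderiv' hg
  have k1 := tangentProj_second_deriv (c := c₁) (h := fun z => (g z).1)
    (h0.mono fun z hz => hasFDerivAt_fst hz)
    (((ContinuousLinearMap.compL ℝ E2 W E3
      (ContinuousLinearMap.fst ℝ E3 E3)).hasFDerivAt).comp y h1) (hm.mono fun z hz => hz.1) u v
  have k2 := tangentProj_second_deriv (c := c₂) (h := fun z => (g z).2)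
    (h0.mono fun z hz => hasFDerivAt_snd hz)
    (((ContinuousLinearMap.compL ℝ E2 W E3
      (ContinuousLinearMap.snd ℝ E3 E3)).hasFDerivAt).comp y h1) (hm.mono fun z hz => hz.2) u v
  exact Prod.ext k1 k2

lemma fderiv_fst_mem {c₁ c₂ : ℝ} {g : E2 → W} {y : E2} (hg : ContDiffAt ℝ ∞ g y)
    (hm : ∀ᶠ z in 𝓝 y, g z ∈ productSpace c₁ c₂) (v : E2) :
    (fderiv ℝ g y v).1 ∈ tangentPlane c₁ (g y).1 :=
  fderiv_mem_tangentPlane (hasFDerivAt_fst (hasFDerivAt_fderiv hg)) (hm.mono fun _ hz => hz.1) v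

lemma fderiv_snd_mem {c₁ c₂ : ℝ} {g : E2 → W} {y : E2} (hg : ContDiffAt ℝ ∞ g y)
    (hm : ∀ᶠ z in 𝓝 y, g z ∈ productSpace c₁ c₂) (v : E2) :
    (fderiv ℝ g y v).2 ∈ tangentPlane c₂ (g y).2 :=
  fderiv_mem_tangentPlane (hasFDerivAt_snd (hasFDerivAt_fderiv hg)) (hm.mono fun _ hz => hz.2) v

/-- A differentiable family of vectors in the ranges of a differentiable family of injective
maps has differentiable coordinates. -/
lemma exists_differentiableAt_preimage {E F G : Type*} [NormedAddCommGroup E] [NormedSpace ℝ E]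
    [NormedAddCommGroup F] [NormedSpace ℝ F] [FiniteDimensional ℝ F] [NormedAddCommGroup G]
    [NormedSpace ℝ G] [FiniteDimensional ℝ G] {L : E → F →L[ℝ] G} {k : E → G} {y : E}
    (hL : DifferentiableAt ℝ L y) (hk : DifferentiableAt ℝ k y)
    (hinj : Function.Injective (L y)) (hr : ∀ᶠ z in 𝓝 y, ∃ r, k z = L z r) :
    ∃ γ : E → F, DifferentiableAt ℝ γ y ∧ ∀ᶠ z in 𝓝 y, k z = L z (γ z) := by
  obtain ⟨P, hP⟩ := (L y).toLinearMap.exists_leftInverse_of_injective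
    (LinearMap.ker_eq_bot.mpr hinj)
  let P' : G →L[ℝ] F := LinearMap.toContinuousLinearMap P
  have hPy : P'.comp (L y) = (ContinuousLinearEquiv.refl ℝ F : F →L[ℝ] F) := by
    ext r
    exact DFunLike.congr_fun hP r
  have hd : DifferentiableAt ℝ (fun z => P'.comp (L z)) y :=
    (differentiableAt_const P').clm_comp hL
  have : CompleteSpace F := FiniteDimensional.complete ℝ F
  have hi : DifferentiableAt ℝ (fun z => ContinuousLinearMap.inverse (P'.comp (L z))) y := by
    have h1 := (contDiffAt_map_inverse (𝕜 := ℝ) (n := 1)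
      (ContinuousLinearEquiv.refl ℝ F)).differentiableAt (by simp)
    rw [← hPy] at h1
    exact h1.comp y hd
  refine ⟨fun z => ContinuousLinearMap.inverse (P'.comp (L z)) (P' (k z)),
    hi.clm_apply (P'.differentiableAt.comp y hk), ?_⟩
  have hn : ∀ᶠ z in 𝓝 y, P'.comp (L z) ∈
      Set.range ((↑) : (F ≃L[ℝ] F) → F →L[ℝ] F) := by
    apply hd.continuousAt.eventually
    simp only [hPy]
    exact ContinuousLinearEquiv.nhds _
  filter_upwards [hr, hn] with z ⟨r, hr⟩ ⟨e, he⟩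
  have h1 : P' (L z r) = e r := by rw [← ContinuousLinearMap.comp_apply, ← he]; rfl
  rw [hr, ← he, ContinuousLinearMap.inverse_equiv, h1]
  simp

section Local

variable {c₁ c₂ : ℝ} {g : E2 → W} {y : E2}

lemma ambientForm_smul_eq_zero {c : ℝ} {x v : E3} (hv : v ∈ tangentPlane c x) (k : ℝ) :
    ambientForm c ((c * k) • x) v = 0 := by
  rw [map_smul, LinearMap.smul_apply, smul_eq_mul]
  linear_combination k * mul_ambientForm_of_mem hv

/-- The pencil forms are parallel for the connection induced on a totally geodesic surface. -/
lemma fderiv_pencil (hg : ∀ᶠ z in 𝓝 y, IsGeodesicAt c₁ c₂ g z) (w : E2) :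
    ∃ Γ : E2 → E2, ∀ s t u v,
      DifferentiableAt ℝ (fun z => pencil c₁ c₂ s t (fderiv ℝ g z).toLinearMap u v) y ∧
      fderiv ℝ (fun z => pencil c₁ c₂ s t (fderiv ℝ g z).toLinearMap u v) y w =
        pencil c₁ c₂ s t (fderiv ℝ g y).toLinearMap (Γ u) v +
          pencil c₁ c₂ s t (fderiv ℝ g y).toLinearMap u (Γ v) := by
  have hy := hg.self_of_nhds
  choose Γ hΓ using hy.range w
  refine ⟨Γ, fun s t u v => ?_⟩
  have hm : ∀ᶠ z in 𝓝 y, g z ∈ productSpace c₁ c₂ := hg.mono fun z hz => hz.mem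
  have hL : ∀ u, HasFDerivAt (fun z => fderiv ℝ g z u) ((fderiv ℝ (fderiv ℝ g) y).flip u) y :=
    fun u => by simpa using
      (hasFDerivAt_fderiv' hy.contDiffAt).clm_apply (hasFDerivAt_const u y)
  obtain ⟨D₁, h₁, e₁⟩ := exists_hasFDerivAt_ambientForm c₁ (hasFDerivAt_fst (hL u))
    (hasFDerivAt_fst (hL v))
  obtain ⟨D₂, h₂, e₂⟩ := exists_hasFDerivAt_ambientForm c₂ (hasFDerivAt_snd (hL u))
    (hasFDerivAt_snd (hL v))
  have h := (h₁.const_mul s).add (h₂.const_mul t)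
  have h' : HasFDerivAt (fun z => pencil c₁ c₂ s t (fderiv ℝ g z).toLinearMap u v)
    (s • D₁ + t • D₂) y := h
  refine ⟨h'.differentiableAt, ?_⟩
  have f1 := fun v => fderiv_fst_mem hy.contDiffAt hm v
  have f2 := fun v => fderiv_snd_mem hy.contDiffAt hm v
  rw [h'.fderiv]
  simp only [pencil_apply, ContinuousLinearMap.coe_coe, ← hΓ, add_apply,
    smul_apply, e₁, e₂, normalCorrection, Prod.fst_add, Prod.snd_add, map_add,
    LinearMap.add_apply, ambientForm_smul_eq_zero (f1 _), ambientForm_smul_eq_zero (f2 _)]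
  rw [ambientForm_comm c₁ _ ((c₁ * _) • _), ambientForm_comm c₂ _ ((c₂ * _) • _),
    ambientForm_smul_eq_zero (f1 _), ambientForm_smul_eq_zero (f2 _)]
  simp only [ContinuousLinearMap.comp_apply, ContinuousLinearMap.coe_fst',
    ContinuousLinearMap.coe_snd', ContinuousLinearMap.flip_apply, smul_eq_mul]
  ring

/-- All Gram determinants of the pencil have the same logarithmic derivative. -/
lemma fderiv_pencilDet (hg : ∀ᶠ z in 𝓝 y, IsGeodesicAt c₁ c₂ g z) (w : E2) :
    ∃ τ : ℝ, ∀ s t,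
      DifferentiableAt ℝ (fun z => pencilDet c₁ c₂ s t (fderiv ℝ g z).toLinearMap) y ∧
      fderiv ℝ (fun z => pencilDet c₁ c₂ s t (fderiv ℝ g z).toLinearMap) y w =
        τ * pencilDet c₁ c₂ s t (fderiv ℝ g y).toLinearMap := by
  obtain ⟨Γ, hΓ⟩ := fderiv_pencil hg w
  refine ⟨2 * (planeBasis.repr (Γ (planeBasis 0)) 0 + planeBasis.repr (Γ (planeBasis 1)) 1),
    fun s t => ?_⟩
  simp only [pencilDet_eq]
  obtain ⟨d00, e00⟩ := hΓ s t (planeBasis 0) (planeBasis 0)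
  obtain ⟨d11, e11⟩ := hΓ s t (planeBasis 1) (planeBasis 1)
  obtain ⟨d01, e01⟩ := hΓ s t (planeBasis 0) (planeBasis 1)
  have h := (d00.hasFDerivAt.mul d11.hasFDerivAt).sub (d01.hasFDerivAt.pow 2)
  refine ⟨h.differentiableAt, ?_⟩
  refine (congrArg (fun D : E2 →L[ℝ] ℝ => D w) h.fderiv).trans ?_
  simp only [sub_apply, add_apply,
    smul_apply, e00, e11, e01, smul_eq_mul]
  have r : ∀ i, Γ (planeBasis i) = planeBasis.repr (Γ (planeBasis i)) 0 • planeBasis 0 +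
      planeBasis.repr (Γ (planeBasis i)) 1 • planeBasis 1 := fun i => by
    conv_lhs => rw [← planeBasis.sum_repr (Γ (planeBasis i)), Fin.sum_univ_two]
  rw [r 0, r 1]
  simp only [map_add, map_smul, LinearMap.add_apply, LinearMap.smul_apply, smul_eq_mul,
    pencil_comm _ _ _ _ _ (planeBasis 1) (planeBasis 0)]
  simp
  ring

lemma fderiv_pencilDet_ratio (hg : ∀ᶠ z in 𝓝 y, IsGeodesicAt c₁ c₂ g z)
    (h0 : pencilDet c₁ c₂ 1 1 (fderiv ℝ g y).toLinearMap ≠ 0) (s t : ℝ) :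
    HasFDerivAt (fun z => pencilDet c₁ c₂ s t (fderiv ℝ g z).toLinearMap /
      pencilDet c₁ c₂ 1 1 (fderiv ℝ g z).toLinearMap) (0 : E2 →L[ℝ] ℝ) y := by
  have d : ∀ s t, DifferentiableAt ℝ
      (fun z => pencilDet c₁ c₂ s t (fderiv ℝ g z).toLinearMap) y :=
    fun s t => ((fderiv_pencilDet hg 0).choose_spec s t).1
  have h := (d s t).hasFDerivAt.mul ((hasDerivAt_inv h0).comp_hasFDerivAt y (d 1 1).hasFDerivAt)
  simp only [div_eq_mul_inv]
  refine HasFDerivAt.congr_fderiv h ?_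
  ext w
  obtain ⟨τ, hτ⟩ := fderiv_pencilDet hg w
  simp only [smul_apply, add_apply, (hτ s t).2, (hτ 1 1).2, smul_eq_mul, zero_apply,
    Function.comp_apply]
  field_simp
  ring

/-- The Codazzi equation: tangent planes of totally geodesic surfaces are curvature invariant. -/
lemma curvatureInvariant_of_isGeodesicAt (hg : ∀ᶠ z in 𝓝 y, IsGeodesicAt c₁ c₂ g z) :
    CurvatureInvariant c₁ c₂ (fderiv ℝ g y).toLinearMap := by
  have hy := hg.self_of_nhds
  have hm : ∀ᶠ z in 𝓝 y, g z ∈ productSpace c₁ c₂ := hg.mono fun z hz => hz.mem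
  have hL := hasFDerivAt_fderiv hy.contDiffAt
  have hL' := hasFDerivAt_fderiv' hy.contDiffAt
  have hH := hasFDerivAt_fderiv' (contDiffAt_fderiv hy.contDiffAt)
  have hLu : ∀ u, HasFDerivAt (fun z => fderiv ℝ g z u) ((fderiv ℝ (fderiv ℝ g) y).flip u) y :=
    fun u => by simpa using hL'.clm_apply (hasFDerivAt_const u y)
  have hs : minSmoothness ℝ 2 ≤ ∞ := by
    rw [minSmoothness_of_isRCLikeNormedField]
    exact (mod_cast le_top : ((2 : ℕ∞) : WithTop ℕ∞) ≤ ∞)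
  have symH : ∀ u v, fderiv ℝ (fderiv ℝ g) y u v = fderiv ℝ (fderiv ℝ g) y v u := fun u v =>
    (hy.contDiffAt.isSymmSndFDerivAt hs).eq u v
  have symT : ∀ u v, fderiv ℝ (fderiv ℝ (fderiv ℝ g)) y u v =
      fderiv ℝ (fderiv ℝ (fderiv ℝ g)) y v u := fun u v =>
    ((contDiffAt_fderiv hy.contDiffAt).isSymmSndFDerivAt hs).eq u v
  set H := fderiv ℝ (fderiv ℝ g) y with hHdef
  set T := fderiv ℝ (fderiv ℝ (fderiv ℝ g)) y with hTdef
  set L := fderiv ℝ g y with hLdef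
  have third : ∀ u v w, ∃ r, T w v u +
      ((c₁ * (ambientForm c₁ (H w v).1 (L u).1 + ambientForm c₁ (L v).1 (H w u).1 +
          ambientForm c₁ (L w).1 (H v u).1)) • (g y).1 +
        (c₁ * ambientForm c₁ (L v).1 (L u).1) • (L w).1,
       (c₂ * (ambientForm c₂ (H w v).2 (L u).2 + ambientForm c₂ (L v).2 (H w u).2 +
          ambientForm c₂ (L w).2 (H v u).2)) • (g y).2 +
        (c₂ * ambientForm c₂ (L v).2 (L u).2) • (L w).2) = L r := by
    intro u v w
    obtain ⟨D₁, h₁, e₁⟩ := exists_hasFDerivAt_ambientForm c₁ (hasFDerivAt_fst (hLu v))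
      (hasFDerivAt_fst (hLu u))
    obtain ⟨D₂, h₂, e₂⟩ := exists_hasFDerivAt_ambientForm c₂ (hasFDerivAt_snd (hLu v))
      (hasFDerivAt_snd (hLu u))
    have hN := ((h₁.const_mul c₁).smul (hasFDerivAt_fst hL)).prodMk
      ((h₂.const_mul c₂).smul (hasFDerivAt_snd hL))
    have hHuv : HasFDerivAt (fun z => fderiv ℝ (fderiv ℝ g) z v u) ((T.flip v).flip u) y := by
      have := (hH.clm_apply (hasFDerivAt_const v y)).clm_apply (hasFDerivAt_const u y)
      refine this.congr_fderiv ?_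
      ext1 x
      simp [hTdef]
    have hk := hHuv.add hN
    obtain ⟨γ, hγ, hγe⟩ := exists_differentiableAt_preimage hL'.differentiableAt
      hk.differentiableAt hy.injective (hg.mono fun z hz => hz.range v u)
    have hR := hL'.clm_apply hγ.hasFDerivAt
    have hu := (hk.congr_of_eventuallyEq (hγe.mono fun z hz => hz.symm)).unique hR
    have huw := DFunLike.congr_fun hu w
    have hy0 : H v u + normalCorrection c₁ c₂ (g y) (L v) (L u) = L (γ y) := hγe.self_of_nhds
    obtain ⟨r, hr⟩ := hy.range w (γ y)
    refine ⟨fderiv ℝ γ y w + r, ?_⟩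
    have h4 : T w v u +
        ((c₁ * (ambientForm c₁ (H w v).1 (L u).1 + ambientForm c₁ (L v).1 (H w u).1)) • (g y).1 +
          (c₁ * ambientForm c₁ (L v).1 (L u).1) • (L w).1,
         (c₂ * (ambientForm c₂ (H w v).2 (L u).2 + ambientForm c₂ (L v).2 (H w u).2)) • (g y).2 +
          (c₂ * ambientForm c₂ (L v).2 (L u).2) • (L w).2) =
        L (fderiv ℝ γ y w) + H w (γ y) := by
      refine Eq.trans ?_ huw
      refine Prod.ext ?_ ?_
      · simp only [← hLdef, e₁, add_apply, ContinuousLinearMap.flip_apply,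
          ContinuousLinearMap.prod_apply, smul_apply, ContinuousLinearMap.smulRight_apply,
          Prod.fst_add, ContinuousLinearMap.comp_apply, ContinuousLinearMap.coe_fst', smul_eq_mul]
        module
      · simp only [← hLdef, e₂, add_apply, ContinuousLinearMap.flip_apply,
          ContinuousLinearMap.prod_apply, smul_apply, ContinuousLinearMap.smulRight_apply,
          Prod.snd_add, ContinuousLinearMap.comp_apply, ContinuousLinearMap.coe_snd', smul_eq_mul]
        module
    have h5 : normalCorrection c₁ c₂ (g y) (L w) (L (γ y)) =
        ((c₁ * ambientForm c₁ (L w).1 (H v u).1) • (g y).1,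
          (c₂ * ambientForm c₂ (L w).2 (H v u).2) • (g y).2) := by
      rw [← hy0]
      simp only [normalCorrection, Prod.fst_add, Prod.snd_add, map_add]
      rw [ambientForm_comm c₁ _ ((c₁ * _) • _), ambientForm_comm c₂ _ ((c₂ * _) • _),
        ambientForm_smul_eq_zero (fderiv_fst_mem hy.contDiffAt hm w),
        ambientForm_smul_eq_zero (fderiv_snd_mem hy.contDiffAt hm w), add_zero, add_zero]
    rw [map_add, ← hr, h5, ← add_assoc, ← h4]
    refine Prod.ext ?_ ?_ <;> simp only [Prod.fst_add, Prod.snd_add] <;> module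
  intro u v w
  obtain ⟨r, hr⟩ := third u v w
  obtain ⟨r', hr'⟩ := third u w v
  refine ⟨r - r', ?_⟩
  change L (r - r') = _
  rw [map_sub, ← hr, ← hr', symT v w, symH v w]
  refine Prod.ext ?_ ?_
  · simp only [Prod.fst_add, Prod.fst_sub, ContinuousLinearMap.coe_coe]
    rw [ambientForm_comm c₁ (L v).1 (H w u).1, ambientForm_comm c₁ (L w).1 (H v u).1,
      ambientForm_comm c₁ (L v).1 (L u).1, ambientForm_comm c₁ (L w).1 (L u).1]
    module
  · simp only [Prod.snd_add, Prod.snd_sub, ContinuousLinearMap.coe_coe]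
    rw [ambientForm_comm c₂ (L v).2 (H w u).2, ambientForm_comm c₂ (L w).2 (H v u).2,
      ambientForm_comm c₂ (L v).2 (L u).2, ambientForm_comm c₂ (L w).2 (L u).2]
    module

end Local

/-- Totally geodesic immersions are preserved by changes of parameters. -/
lemma IsGeodesicAt.of_comp {c₁ c₂ : ℝ} {g k : E2 → W} {σ τ : E2 → E2} {y z : E2}
    (hk : IsGeodesicAt c₁ c₂ k z) (hg : ContDiffAt ℝ ∞ g y) (hτ : ContDiffAt ℝ ∞ τ y)
    (hσ : ContDiffAt ℝ ∞ σ z) (hτy : τ y = z) (hσz : σ z = y)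
    (hgk : g =ᶠ[𝓝 y] k ∘ τ) (hkg : k =ᶠ[𝓝 z] g ∘ σ) :
    IsGeodesicAt c₁ c₂ g y := by
  subst hτy
  have hgy : g y = k (τ y) := hgk.self_of_nhds
  have hkd : ∀ᶠ w in 𝓝 (τ y), DifferentiableAt ℝ k w :=
    ((hk.contDiffAt.of_le (m := 1) (by simp)).eventually (by simp)).mono fun w hw =>
      hw.differentiableAt (by simp)
  have hτd : ∀ᶠ w in 𝓝 y, DifferentiableAt ℝ τ w :=
    ((hτ.of_le (m := 1) (by simp)).eventually (by simp)).mono fun w hw =>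
      hw.differentiableAt (by simp)
  have hDg : ∀ᶠ w in 𝓝 y, fderiv ℝ g w = (fderiv ℝ k (τ w)).comp (fderiv ℝ τ w) := by
    filter_upwards [hgk.eventually_nhds, hτ.continuousAt.eventually hkd, hτd] with w h1 h2 h3
    rw [Filter.EventuallyEq.fderiv_eq h1, fderiv_comp w h2 h3]
  have hDgy := hDg.self_of_nhds
  have hDk : fderiv ℝ k (τ y) = (fderiv ℝ g y).comp (fderiv ℝ σ (τ y)) := by
    rw [hkg.fderiv_eq, fderiv_comp _ (by rw [hσz]; exact hg.differentiableAt (by simp))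
      (hσ.differentiableAt (by simp)), hσz]
  have hinj : Function.Injective (fderiv ℝ σ (τ y)) := by
    have h := hk.injective
    rw [hDk, ContinuousLinearMap.coe_comp] at h
    exact h.of_comp
  have hsurj : Function.Surjective (fderiv ℝ σ (τ y)) :=
    (LinearMap.injective_iff_surjective (f := (fderiv ℝ σ (τ y)).toLinearMap)).mp hinj
  refine ⟨hg, hgy ▸ hk.mem, ?_, fun u v => ?_⟩
  · intro a b hab
    obtain ⟨a', rfl⟩ := hsurj a
    obtain ⟨b', rfl⟩ := hsurj b
    rw [← ContinuousLinearMap.comp_apply, ← ContinuousLinearMap.comp_apply, ← hDk] at hab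
    rw [hk.injective hab]
  · have h1 : HasFDerivAt (fun w => fderiv ℝ g w v) ((fderiv ℝ (fderiv ℝ g) y).flip v) y := by
      simpa using (hasFDerivAt_fderiv' hg).clm_apply (hasFDerivAt_const v y)
    have h2 := ((hasFDerivAt_fderiv' hk.contDiffAt).comp y
      (hτ.differentiableAt (by simp)).hasFDerivAt).clm_apply
      ((hasFDerivAt_fderiv' hτ).clm_apply (hasFDerivAt_const v y))
    have h3 := h1.unique (h2.congr_of_eventuallyEq
      (hDg.mono fun w hw => DFunLike.congr_fun hw v))
    have h4 := DFunLike.congr_fun h3 u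
    simp at h4
    obtain ⟨r, hr⟩ := hk.range (fderiv ℝ τ y u) (fderiv ℝ τ y v)
    refine ⟨fderiv ℝ σ (τ y) (r + fderiv ℝ (fderiv ℝ τ) y u v), ?_⟩
    rw [← ContinuousLinearMap.comp_apply, ← hDk, map_add, ← hr, h4, hgy, hDgy]
    simp only [ContinuousLinearMap.comp_apply]
    abel

namespace ImmersedSurface

variable {c₁ c₂ : ℝ} {M : Type*} [TopologicalSpace M] [ChartedSpace E2 M]
  [IsManifold (𝓡 2) ∞ M]

/-- The immersion in the preferred chart at `p`. -/
def param (ψ : ImmersedSurface c₁ c₂ M) (p : M) : E2 → W :=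
  ψ.toFun ∘ (extChartAt (𝓡 2) p).symm

lemma contDiffAt_param (ψ : ImmersedSurface c₁ c₂ M) {p : M} {y : E2}
    (hy : y ∈ (extChartAt (𝓡 2) p).target) : ContDiffAt ℝ ∞ (ψ.param p) y := by
  have h1 : ContMDiffAt 𝓘(ℝ, E2) (𝓡 2) ∞ (extChartAt (𝓡 2) p).symm y :=
    (contMDiffOn_extChartAt_symm p).contMDiffAt (extChartAt_target_mem_nhds' hy)
  exact ((ψ.contMDiff _).comp y h1).contDiffAt

/-- The differential at `p`, in the coordinates of the preferred chart at `p`. -/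
def coordDiff (ψ : ImmersedSurface c₁ c₂ M) (p : M) : E2 →ₗ[ℝ] W := ψ.diff p

/-- The tensor `f` at `p`, in the coordinates of the preferred chart at `p`. -/
def coordF (ψ : ImmersedSurface c₁ c₂ M) (p : M) : E2 →ₗ[ℝ] E2 := ψ.f p

lemma coordDiff_injective (ψ : ImmersedSurface c₁ c₂ M) (p : M) :
    Function.Injective (ψ.coordDiff p) := ψ.injective_mfderiv p

lemma coordDiff_eq (ψ : ImmersedSurface c₁ c₂ M) (p : M) :
    ψ.coordDiff p = (fderiv ℝ (ψ.param p) (extChartAt (𝓡 2) p p)).toLinearMap := by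
  have h : MDifferentiableAt (𝓡 2) 𝓘(ℝ, W) ψ.toFun p :=
    (ψ.contMDiff p).mdifferentiableAt (by simp)
  have h1 : fderivWithin ℝ (writtenInExtChartAt (𝓡 2) 𝓘(ℝ, W) p ψ.toFun) (Set.range (𝓡 2))
      (extChartAt (𝓡 2) p p) = fderiv ℝ (ψ.param p) (extChartAt (𝓡 2) p p) := by
    rw [ModelWithCorners.range_eq_univ, fderivWithin_univ]
    rfl
  rw [← h1]
  exact congrArg (fun A : E2 →L[ℝ] W => A.toLinearMap) h.mfderiv

lemma contDiffAt_transition {p q m : M} (hp : m ∈ (extChartAt (𝓡 2) p).source)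
    (hq : m ∈ (extChartAt (𝓡 2) q).source) :
    ContDiffAt ℝ ∞ (extChartAt (𝓡 2) q ∘ (extChartAt (𝓡 2) p).symm) (extChartAt (𝓡 2) p m) := by
  have h := contDiffWithinAt_ext_coord_change (I := 𝓡 2) (n := ∞) q p
    (y := extChartAt (𝓡 2) p m) (by
      rw [PartialEquiv.trans_source, PartialEquiv.symm_source]
      refine ⟨(extChartAt (𝓡 2) p).map_source hp, ?_⟩
      rwa [Set.mem_preimage, (extChartAt (𝓡 2) p).left_inv hp])
  rwa [ModelWithCorners.range_eq_univ, contDiffWithinAt_univ] at h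

lemma param_eventuallyEq (ψ : ImmersedSurface c₁ c₂ M) {p q m : M}
    (hp : m ∈ (extChartAt (𝓡 2) p).source) (hq : m ∈ (extChartAt (𝓡 2) q).source) :
    ψ.param p =ᶠ[𝓝 (extChartAt (𝓡 2) p m)]
      ψ.param q ∘ (extChartAt (𝓡 2) q ∘ (extChartAt (𝓡 2) p).symm) := by
  have h1 : ∀ᶠ z in 𝓝 (extChartAt (𝓡 2) p m),
      (extChartAt (𝓡 2) p).symm z ∈ (extChartAt (𝓡 2) q).source := by
    refine (continuousAt_extChartAt_symm' hp).eventually ?_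
    rw [(extChartAt (𝓡 2) p).left_inv hp]
    exact extChartAt_source_mem_nhds' hq
  filter_upwards [h1] with z hz
  simp only [param, Function.comp_apply, (extChartAt (𝓡 2) q).left_inv hz]

lemma isGeodesicAt_self (ψ : ImmersedSurface c₁ c₂ M) (hψ : ψ.IsTotallyGeodesic) (p : M) :
    IsGeodesicAt c₁ c₂ (ψ.param p) (extChartAt (𝓡 2) p p) := by
  have hc := ψ.contDiffAt_param (mem_extChartAt_target (I := 𝓡 2) p)
  have hm : ∀ z, ψ.param p z ∈ productSpace c₁ c₂ := fun z => ψ.mem_productSpace _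
  refine ⟨hc, hm _, ?_, fun u v => ?_⟩
  · have h := ψ.coordDiff_injective p
    rw [coordDiff_eq] at h
    exact h
  · rw [← productTangentProj_second_deriv hc (Eventually.of_forall hm)]
    have h := sub_eq_zero.mp (hψ p u v)
    have h1 : HasFDerivAt (fun w => fderiv ℝ (ψ.param p) w v)
        ((fderiv ℝ (fderiv ℝ (ψ.param p)) (extChartAt (𝓡 2) p p)).flip v)
        (extChartAt (𝓡 2) p p) := by
      simpa using (hasFDerivAt_fderiv' hc).clm_apply (hasFDerivAt_const v _)
    have h2 : ψ.covDeriv p u v = productTangentProj c₁ c₂ (ψ.param p (extChartAt (𝓡 2) p p))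
        (fderiv ℝ (fderiv ℝ (ψ.param p)) (extChartAt (𝓡 2) p p) u v) := by
      have h3 := DFunLike.congr_fun h1.fderiv u
      rw [ContinuousLinearMap.flip_apply] at h3
      rw [← h3, param, Function.comp_apply, extChartAt_to_inv]
      rfl
    rw [← h2, h]
    exact ⟨_, DFunLike.congr_fun (ψ.coordDiff_eq p) _⟩

lemma isGeodesicAt (ψ : ImmersedSurface c₁ c₂ M) (hψ : ψ.IsTotallyGeodesic) {p : M} {y : E2}
    (hy : y ∈ (extChartAt (𝓡 2) p).target) : IsGeodesicAt c₁ c₂ (ψ.param p) y := by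
  set q := (extChartAt (𝓡 2) p).symm y with hq
  have hpq : q ∈ (extChartAt (𝓡 2) p).source := (extChartAt (𝓡 2) p).map_target hy
  have hqq : q ∈ (extChartAt (𝓡 2) q).source := mem_extChartAt_source q
  have hyq : extChartAt (𝓡 2) p q = y := (extChartAt (𝓡 2) p).right_inv hy
  rw [← hyq]
  refine (ψ.isGeodesicAt_self hψ q).of_comp (ψ.contDiffAt_param (hyq ▸ hy))
    (contDiffAt_transition hpq hqq) (contDiffAt_transition hqq hpq) ?_ ?_
    (ψ.param_eventuallyEq hpq hqq) (ψ.param_eventuallyEq hqq hpq)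
  · rw [Function.comp_apply, (extChartAt (𝓡 2) p).left_inv hpq]
  · rw [Function.comp_apply, (extChartAt (𝓡 2) q).left_inv hqq]

lemma coordDiff_eq_comp (ψ : ImmersedSurface c₁ c₂ M) {p q : M}
    (hq : q ∈ (extChartAt (𝓡 2) p).source) :
    ∃ T : E2 →ₗ[ℝ] E2, LinearMap.det T ≠ 0 ∧
      ψ.coordDiff q = (fderiv ℝ (ψ.param p) (extChartAt (𝓡 2) p q)).toLinearMap ∘ₗ T := by
  have hqq : q ∈ (extChartAt (𝓡 2) q).source := mem_extChartAt_source q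
  have hs := contDiffAt_transition hqq hq
  set σ := extChartAt (𝓡 2) p ∘ (extChartAt (𝓡 2) q).symm with hσ
  have hsq : σ (extChartAt (𝓡 2) q q) = extChartAt (𝓡 2) p q := by
    rw [hσ, Function.comp_apply, (extChartAt (𝓡 2) q).left_inv hqq]
  have hd : fderiv ℝ (ψ.param q) (extChartAt (𝓡 2) q q) =
      (fderiv ℝ (ψ.param p) (extChartAt (𝓡 2) p q)).comp
        (fderiv ℝ σ (extChartAt (𝓡 2) q q)) := by
    rw [(ψ.param_eventuallyEq hqq hq).fderiv_eq, ← hσ, fderiv_comp, hsq]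
    · rw [hsq]
      exact (ψ.contDiffAt_param ((extChartAt (𝓡 2) p).map_source hq)).differentiableAt (by simp)
    · exact hs.differentiableAt (by simp)
  have hL : ψ.coordDiff q = (fderiv ℝ (ψ.param p) (extChartAt (𝓡 2) p q)).toLinearMap ∘ₗ
      (fderiv ℝ σ (extChartAt (𝓡 2) q q)).toLinearMap := by
    rw [coordDiff_eq, hd]
    rfl
  refine ⟨_, ?_, hL⟩
  have hinj := ψ.coordDiff_injective q
  rw [hL, LinearMap.coe_comp] at hinj
  have hker := LinearMap.ker_eq_bot.mpr hinj.of_comp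
  intro h0
  exact (LinearMap.bot_lt_ker_of_det_eq_zero h0).ne' hker

lemma pencil_coordDiff_apply (ψ : ImmersedSurface c₁ c₂ M) (p : M) (u v : E2) :
    pencil c₁ c₂ 1 1 (ψ.coordDiff p) u v = ψ.metric p u v := by
  rw [pencil_apply, one_mul, one_mul]
  rfl

lemma pencil_coordDiff_pos (ψ : ImmersedSurface c₁ c₂ M) (p : M) {u : E2} (hu : u ≠ 0) :
    0 < pencil c₁ c₂ 1 1 (ψ.coordDiff p) u u := by
  rw [pencil_coordDiff_apply]
  exact ψ.metric_pos p hu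

lemma pencil_coordF (ψ : ImmersedSurface c₁ c₂ M) (p : M) (u v : E2) :
    pencil c₁ c₂ 1 1 (ψ.coordDiff p) u (ψ.coordF p v) =
      pencil c₁ c₂ 1 (-1) (ψ.coordDiff p) u v := by
  have h := ψ.productForm_sub_tangentPart p (productStructure (ψ.coordDiff p v)) u
  rw [map_sub, LinearMap.sub_apply, sub_eq_zero] at h
  have h' : pencil c₁ c₂ 1 1 (ψ.coordDiff p) (ψ.coordF p v) u =
      productForm c₁ c₂ (productStructure (ψ.coordDiff p v)) (ψ.coordDiff p u) := by
    rw [pencil_coordDiff_apply]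
    exact h.symm
  rw [pencil_comm, h', pencil_comm]
  simp [productForm_apply, pencil_apply, productStructure]

lemma pencilDet_coordDiff_ne_zero (ψ : ImmersedSurface c₁ c₂ M) (p : M) :
    pencilDet c₁ c₂ 1 1 (ψ.coordDiff p) ≠ 0 := by
  refine (LinearMap.BilinForm.nondegenerate_iff_det_ne_zero planeBasis).mp ⟨?_, ?_⟩ <;>
  · intro u hu
    by_contra h
    exact (ψ.pencil_coordDiff_pos p h).ne' (hu u)

lemma pencilDet_param_ne_zero (ψ : ImmersedSurface c₁ c₂ M) {p q : M}
    (hq : q ∈ (extChartAt (𝓡 2) p).source) :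
    pencilDet c₁ c₂ 1 1 (fderiv ℝ (ψ.param p) (extChartAt (𝓡 2) p q)).toLinearMap ≠ 0 := by
  obtain ⟨T, hT, h⟩ := ψ.coordDiff_eq_comp hq
  have h1 := ψ.pencilDet_coordDiff_ne_zero q
  rw [h, pencilDet_comp] at h1
  exact right_ne_zero_of_mul h1

lemma eval_charpoly_coordF (ψ : ImmersedSurface c₁ c₂ M) {p q : M}
    (hq : q ∈ (extChartAt (𝓡 2) p).source) (x : ℝ) :
    (ψ.coordF q).charpoly.eval x =
      pencilDet c₁ c₂ (x - 1) (x + 1)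
          (fderiv ℝ (ψ.param p) (extChartAt (𝓡 2) p q)).toLinearMap /
        pencilDet c₁ c₂ 1 1 (fderiv ℝ (ψ.param p) (extChartAt (𝓡 2) p q)).toLinearMap := by
  obtain ⟨T, hT, h⟩ := ψ.coordDiff_eq_comp hq
  have h1 := eval_charpoly_mul_pencilDet (ψ.pencil_coordF q) x
  rw [h, pencilDet_comp, pencilDet_comp] at h1
  rw [eq_div_iff (ψ.pencilDet_param_ne_zero hq)]
  apply mul_left_cancel₀ (pow_ne_zero 2 hT)
  rw [← h1]
  ring

lemma eventually_charpoly_coordF_eq (ψ : ImmersedSurface c₁ c₂ M) (hψ : ψ.IsTotallyGeodesic) (p : M) :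
    ∀ᶠ q in 𝓝 p, (ψ.coordF q).charpoly = (ψ.coordF p).charpoly := by
  obtain ⟨ε, hε, hB⟩ := Metric.mem_nhds_iff.mp (extChartAt_target_mem_nhds (I := 𝓡 2) p)
  filter_upwards [extChartAt_source_mem_nhds (I := 𝓡 2) p,
    (continuousAt_extChartAt (I := 𝓡 2) p).eventually (Metric.ball_mem_nhds _ hε)] with q hq hqB
  refine Polynomial.funext fun x => ?_
  rw [ψ.eval_charpoly_coordF hq, ψ.eval_charpoly_coordF (mem_extChartAt_source p)]
  have hd : ∀ z ∈ Metric.ball (extChartAt (𝓡 2) p p) ε, HasFDerivAt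
      (fun z => pencilDet c₁ c₂ (x - 1) (x + 1) (fderiv ℝ (ψ.param p) z).toLinearMap /
        pencilDet c₁ c₂ 1 1 (fderiv ℝ (ψ.param p) z).toLinearMap) (0 : E2 →L[ℝ] ℝ) z := by
    intro z hz
    have hzt := hB hz
    refine fderiv_pencilDet_ratio ?_ ?_ _ _
    · filter_upwards [extChartAt_target_mem_nhds' hzt] with w hw
      exact ψ.isGeodesicAt hψ hw
    · rw [← (extChartAt (𝓡 2) p).right_inv hzt]
      exact ψ.pencilDet_param_ne_zero ((extChartAt (𝓡 2) p).map_target hzt)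
  exact Metric.isOpen_ball.is_const_of_fderiv_eq_zero (convex_ball _ _).isPreconnected
    (fun z hz => (hd z hz).differentiableAt.differentiableWithinAt)
    (fun z hz => (hd z hz).fderiv) hqB (Metric.mem_ball_self hε)

lemma charpoly_coordF_eq [PreconnectedSpace M] (ψ : ImmersedSurface c₁ c₂ M)
    (hψ : ψ.IsTotallyGeodesic) (p q : M) : (ψ.coordF p).charpoly = (ψ.coordF q).charpoly :=
  ((IsLocallyConstant.iff_eventually_eq fun p => (ψ.coordF p).charpoly).mpr
    (ψ.eventually_charpoly_coordF_eq hψ)).apply_eq_of_preconnectedSpace p q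

/-- The eigenvalues of `f` lie in `[-1, 1]` and satisfy the Codazzi equations. -/
lemma exists_eigenvalues (ψ : ImmersedSurface c₁ c₂ M) (hψ : ψ.IsTotallyGeodesic) (p : M) :
    ∃ l₁ l₂ : ℝ, ψ.HasEigenvaluesAt p l₁ l₂ ∧ l₁ ∈ Set.Icc (-1) 1 ∧ l₂ ∈ Set.Icc (-1) 1 ∧
      ((c₁ + c₂) / 4 * l₁ + (c₁ - c₂) / 4) * (1 - l₂ ^ 2) = 0 ∧
      ((c₁ + c₂) / 4 * l₂ + (c₁ - c₂) / 4) * (1 - l₁ ^ 2) = 0 := by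
  obtain ⟨X, Y, l₁, l₂, hl, hXX, hYY, hXY, hX, hY, hchar⟩ :=
    exists_orthonormal_eigenbasis (V := E2) (by simp) (pencil c₁ c₂ 1 1 (ψ.coordDiff p))
      (pencil_comm _ _ _ _ _) (fun _ => ψ.pencil_coordDiff_pos p) (ψ.coordF p) (fun u v => by
        rw [pencil_comm, pencil_coordF, pencil_coordF, pencil_comm])
  have hcurv : CurvatureInvariant c₁ c₂ (ψ.coordDiff p) := by
    rw [coordDiff_eq]
    refine curvatureInvariant_of_isGeodesicAt ?_
    filter_upwards [extChartAt_target_mem_nhds (I := 𝓡 2) p] with z hz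
    exact ψ.isGeodesicAt hψ hz
  have hbound : ∀ (Z : E2) (l : ℝ), pencil c₁ c₂ 1 1 (ψ.coordDiff p) Z Z = 1 →
      ψ.coordF p Z = l • Z → l ∈ Set.Icc (-1) 1 := by
    intro Z l h1 h2
    have h3 := ψ.pencil_coordF p Z Z
    rw [h2, map_smul, h1, smul_eq_mul, pencil_apply] at h3
    rw [pencil_apply] at h1
    have n1 : 0 ≤ ambientForm c₁ (ψ.coordDiff p Z).1 (ψ.coordDiff p Z).1 :=
      ambientForm_self_nonneg (ψ.mem_productSpace p).1 (ψ.diff_fst_mem p Z)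
    have n2 : 0 ≤ ambientForm c₂ (ψ.coordDiff p Z).2 (ψ.coordDiff p Z).2 :=
      ambientForm_self_nonneg (ψ.mem_productSpace p).2 (ψ.diff_snd_mem p Z)
    constructor <;> linarith
  exact ⟨l₁, l₂, ⟨hl, hchar⟩, hbound X l₁ hXX hX, hbound Y l₂ hYY hY,
    hcurv.eigenvalue_eq (ψ.pencil_coordF p) hYY hXX hXY hY hX,
    hcurv.eigenvalue_eq (ψ.pencil_coordF p) hXX hYY (by rw [pencil_comm, hXY]) hX hY⟩

end ImmersedSurface

lemma eigenvalueTypes_of_eq {c₁ c₂ l m : ℝ} (hc : ¬ (c₁ = 0 ∧ c₂ = 0))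
    (hl : l ∈ Set.Icc (-1) 1) (hl' : 1 - l ^ 2 ≠ 0)
    (h₁ : ((c₁ + c₂) / 4 * l + (c₁ - c₂) / 4) * (1 - m ^ 2) = 0)
    (h₂ : ((c₁ + c₂) / 4 * m + (c₁ - c₂) / 4) * (1 - l ^ 2) = 0) :
    EigenvalueTypes c₁ c₂ m l := by
  have e₂ := (mul_eq_zero.mp h₂).resolve_right hl'
  by_cases hm : 1 - m ^ 2 = 0
  · have : (m - 1) * (m + 1) = 0 := by linear_combination -hm
    rcases mul_eq_zero.mp this with h | h
    · have hm1 : m = 1 := by linarith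
      subst hm1
      exact .inr <| .inr <| .inr <| .inl ⟨by linarith, rfl, hl⟩
    · have hm1 : m = -1 := by linarith
      subst hm1
      exact .inr <| .inr <| .inr <| .inr ⟨by linarith, rfl, hl⟩
  · have e₁ := (mul_eq_zero.mp h₁).resolve_right hm
    have hs : c₁ + c₂ ≠ 0 := fun h => hc (by
      rw [h] at e₁
      constructor <;> linarith)
    refine .inl ⟨?_, ?_, ?_⟩
    · have hlt : 0 < 1 - l ^ 2 := lt_of_le_of_ne (by nlinarith [hl.1, hl.2]) (Ne.symm hl')
      have : 4 * (c₁ * c₂) = (c₁ + c₂) ^ 2 * (1 - l ^ 2) := by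
        have e : c₁ - c₂ = -((c₁ + c₂) * l) := by linarith
        linear_combination (-(c₁ - c₂) + (c₁ + c₂) * l) * e
      have := mul_pos (pow_pos (abs_pos.mpr hs) 2) hlt
      rw [sq_abs] at this
      linarith
    · rw [eq_div_iff hs]; linarith
    · rw [eq_div_iff hs]; linarith

end ProductSurface

end

theorem mainTheorem12 (c₁ c₂ : ℝ) (hc : ¬ (c₁ = 0 ∧ c₂ = 0))
    {M : Type*} [TopologicalSpace M] [ChartedSpace ProductSurface.E2 M]
    [IsManifold (𝓡 2) ∞ M] [ConnectedSpace M]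
    (ψ : ProductSurface.ImmersedSurface c₁ c₂ M) (hψ : ψ.IsTotallyGeodesic) :
    ψ.IsConstantAngle ∧
    ∃ l₁ l₂ : ℝ, (∀ p : M, ψ.HasEigenvaluesAt p l₁ l₂) ∧
      (((c₁ + c₂) / 4 * l₁ + (c₁ - c₂) / 4) * (1 - l₂ ^ 2) = 0 ∧
        ((c₁ + c₂) / 4 * l₂ + (c₁ - c₂) / 4) * (1 - l₁ ^ 2) = 0) ∧
      (ProductSurface.EigenvalueTypes c₁ c₂ l₁ l₂ ∨
        ProductSurface.EigenvalueTypes c₁ c₂ l₂ l₁) := by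
  obtain ⟨p₀⟩ : Nonempty M := inferInstance
  obtain ⟨l₁, l₂, ⟨hl, hchar⟩, hl₁, hl₂, h₁, h₂⟩ := ψ.exists_eigenvalues hψ p₀
  have hall : ∀ p, ψ.HasEigenvaluesAt p l₁ l₂ := fun p =>
    ⟨hl, (ψ.charpoly_coordF_eq hψ p p₀).trans hchar⟩
  have hcos : ∀ l ∈ Set.Icc (-1 : ℝ) 1, Real.cos (2 * (Real.arccos l / 2)) = l := fun l h => by
    rw [mul_div_cancel₀ _ two_ne_zero, Real.cos_arccos h.1 h.2]
  have hmem : ∀ l : ℝ, Real.arccos l / 2 ∈ Set.Icc 0 (Real.pi / 2) := fun l =>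
    ⟨by linarith [Real.arccos_nonneg l], by linarith [Real.arccos_le_pi l]⟩
  refine ⟨⟨Real.arccos l₁ / 2, Real.arccos l₂ / 2, fun p => ⟨hmem l₁, hmem l₂, ?_⟩⟩,
    l₁, l₂, hall, ⟨h₁, h₂⟩, ?_⟩
  · rw [hcos l₁ hl₁, hcos l₂ hl₂]
    exact hall p
  by_cases e₁ : 1 - l₁ ^ 2 = 0
  · by_cases e₂ : 1 - l₂ ^ 2 = 0
    · exact .inl <| .inr <| .inl ⟨sq_eq_one_iff.mp (by linarith),
        sq_eq_one_iff.mp (by linarith)⟩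
    · exact .inl (ProductSurface.eigenvalueTypes_of_eq hc hl₂ e₂ h₂ h₁)
  · exact .inr (ProductSurface.eigenvalueTypes_of_eq hc hl₁ e₁ h₁ h₂)
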